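/- Let $H_n$ be the $n$-dimensional hypercube: the graph on $\{0,1\}^n$ in which two strings are adjacent iff their Hamming distance is $1$, so $|H_n| = 2^n$. For a finite set $A$ of atoms, let $\mathrm{HF}(A)$ be the class of hereditarily finite (h.f.) objects over $A$, i.e. atoms and finite sets of h.f. objects; for $x\in\mathrm{HF}(A)$ let $\mathrm{tc}(x)$ be the least transitive set with $x\in\mathrm{tc}(x)$. Automorphisms of a graph act on h.f. objects over its vertex set by replacing atoms by their images, and likewise on tuples of vertex sets; the orbit of an object is the set of its automorphic images. An h.f. object is symmetric w.r.t. $H_n$ if every automorphism of $H_n$ fixes it, and for a polynomial $p$ it is $p$-bounded w.r.t. $H_n$ if $|\mathrm{tc}(x)|\le p(2^n)$. An h.f. object $x$ over $H_n$ encodes an ordered partition $(C_1,\dots,C_m)$ of $\{0,1\}^n$ (into nonempty parts) if some program of Choiceless Polynomial Time with counting (that is, a polynomially bounded run of a BGS-logic program) computes on input $H_n$ and $x$ the set $\{C_1,\{C_2,\{C_3,\{\dots\}\}\}\}$, whose innermost set is $\{C_m\}$. For each $n\in\mathbb N$ fix an ordered partition $\mathcal P_n$ of $\{0,1\}^n$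 such that, for some constant $c$ and all sufficiently large $n$, all parts of $\mathcal P_n$ have size at most $c\cdot n$ (that is, size $O(n)=O(\log|H_n|)$), and an h.f. object $x_n$ over $H_n$ that encodes $\mathcal P_n$. Then: 1. for every polynomial $p$, the orbit of $\mathcal P_n$ under $\mathrm{Aut}(H_n)$ has more than $p(2^n)$ elements for all sufficiently large $n$; 2. for every polynomial $p$, the orbit of $x_n$ under $\mathrm{Aut}(H_n)$ has more than $p(2^n)$ elements for all sufficiently large $n$; 3. if $(z_n)_{n\in\mathbb N}$ are h.f. objects over $H_n$ such that each $z_n$ is symmetric w.r.t. $H_n$ and $x_n\in\mathrm{tc}(z_n)$ (for instance $z_n=x_n$, if $x_n$ itself is symmetric), then for every polynomial $p$ and all sufficiently large $n$, $z_n$ is not $p$-bounded w.r.t. $H_n$. In particular, there is no polynomial $p$ such that every $z_n$ is $p$-bounded. -/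

import Mathlib

open Filter

/-! ### Hereditarily finite objects over a set of atoms -/

/-- The hereditarily finite objects over the atom set `A`: atoms, and finite sets of hereditarily
finite objects.  (Mathlib's `Finsets A` is the quotient of the hereditarily finite lists over `A`
by extensional equality.) -/
abbrev HF (A : Type*) : Type _ := Finsets A

namespace HF

variable {A B : Type*}

/-- The hereditarily finite object given by a hereditary list. -/
def mk (l : Lists A) : HF A := Quotient.mk _ l

theorem mk_eq_mk {l l' : Lists A} : mk l = mk l' ↔ Lists.Equiv l l' :=
  ⟨fun h => Quotient.exact h, fun h => Quotient.sound h⟩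

/-- An atom, seen as a hereditarily finite object. -/
def atom (a : A) : HF A := mk (Lists.atom a)

theorem exists_toList_of_equiv {l l' : Lists A} (h : Lists.Equiv l l') (x : HF A)
    (hx : ∃ y ∈ l.toList, mk y = x) : ∃ y ∈ l'.toList, mk y = x := by
  obtain ⟨y, hy, rfl⟩ := hx
  cases h with
  | refl => exact ⟨y, hy, rfl⟩
  | antisymm h₁ h₂ =>
    obtain ⟨z, hz, hyz⟩ := Lists'.mem_of_subset' h₁ hy
    exact ⟨z, hz, (mk_eq_mk.2 hyz).symm⟩

open Classical in
/-- The finite set of elements of a hereditarily finite object; an atom has no elements. -/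
noncomputable def members (x : HF A) : Finset (HF A) :=
  Quotient.liftOn x (fun l => (l.toList.map mk).toFinset) (by
    intro l l' h
    ext x
    simp only [List.mem_toFinset, List.mem_map]
    exact ⟨exists_toList_of_equiv h x, exists_toList_of_equiv (Lists.Equiv.symm h) x⟩)

instance : Membership (HF A) (HF A) := ⟨fun x y => y ∈ members x⟩

theorem mem_iff {x y : HF A} : y ∈ x ↔ y ∈ members x := Iff.rfl

open Classical in
theorem mem_members_mk {l : Lists A} {x : HF A} :
    x ∈ members (mk l) ↔ ∃ y ∈ l.toList, mk y = x := by
  change x ∈ (l.toList.map mk).toFinset ↔ _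
  rw [List.mem_toFinset, List.mem_map]

/-- The hereditarily finite set with the given elements. -/
noncomputable def ofFinset (s : Finset (HF A)) : HF A :=
  mk (Lists.ofList (s.toList.map Quotient.out))

theorem members_atom (a : A) : members (atom a) = ∅ := by
  ext x
  rw [atom, mem_members_mk]
  simp

theorem members_ofFinset (s : Finset (HF A)) : members (ofFinset s) = s := by
  ext x
  rw [ofFinset, mem_members_mk, Lists.to_ofList]
  constructor
  · rintro ⟨y, hy, rfl⟩
    obtain ⟨z, hz, rfl⟩ := List.mem_map.1 hy
    rw [show mk (Quotient.out z) = z from Quotient.out_eq z]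
    exact Finset.mem_toList.1 hz
  · intro hx
    exact ⟨_, List.mem_map.2 ⟨x, Finset.mem_toList.2 hx, rfl⟩, Quotient.out_eq x⟩

theorem atom_injective : Function.Injective (atom : A → HF A) := by
  intro a b h
  have h' := Lists.equiv_atom.1 (mk_eq_mk.1 h)
  simp only [Lists.atom] at h'
  cases h'
  rfl

theorem atom_ne_ofFinset (a : A) (s : Finset (HF A)) : atom a ≠ ofFinset s := by
  intro h
  have h' := Lists.equiv_atom.1 (mk_eq_mk.1 h)
  simp only [Lists.atom, Lists.ofList, Lists.of'] at h'
  cases h'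

/-- Extensionality: two non-atoms with the same elements are equal. -/
theorem mk_of'_ext (l₁ l₂ : Lists' A true)
    (h : members (mk (Lists.of' l₁)) = members (mk (Lists.of' l₂))) :
    mk (Lists.of' l₁) = mk (Lists.of' l₂) := by
  have key : ∀ l₁ l₂ : Lists' A true,
      (∀ x, x ∈ members (mk (Lists.of' l₁)) → x ∈ members (mk (Lists.of' l₂))) → l₁ ⊆ l₂ := by
    intro l₁ l₂ h
    rw [Lists'.subset_def]
    intro a ha
    obtain ⟨b, hb, hab⟩ := mem_members_mk.1 (h (mk a) (mem_members_mk.2 ⟨a, ha, rfl⟩))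
    exact ⟨b, hb, (mk_eq_mk.1 hab).symm⟩
  exact mk_eq_mk.2 (Lists.Equiv.antisymm_iff.2
    ⟨key _ _ fun x hx => h ▸ hx, key _ _ fun x hx => h ▸ hx⟩)

theorem ofFinset_members_mk (l : Lists' A true) :
    ofFinset (members (mk (Lists.of' l))) = mk (Lists.of' l) :=
  mk_of'_ext _ _ (members_ofFinset _)

/-- Every hereditarily finite object is an atom or a finite set. -/
theorem eq_atom_or_eq_ofFinset (x : HF A) : (∃ a, x = atom a) ∨ ∃ s, x = ofFinset s := by
  obtain ⟨⟨b, l⟩, rfl⟩ := Quotient.exists_rep x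
  cases b with
  | true => exact Or.inr ⟨_, (ofFinset_members_mk l).symm⟩
  | false => cases l with | atom a => exact Or.inl ⟨a, rfl⟩

/-- Induction along membership. -/
theorem mem_induction {C : HF A → Prop} (hatom : ∀ a, C (atom a))
    (hset : ∀ s : Finset (HF A), (∀ y ∈ s, C y) → C (ofFinset s)) (x : HF A) : C x := by
  have h := Lists.inductionMut (α := A) (fun l => PLift (C (mk l)))
    (fun l => PLift (∀ y ∈ l.toList, C (mk y)))
    (fun a => ⟨hatom a⟩)
    (fun l hl => ⟨by
      rw [← ofFinset_members_mk l]
      apply hset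
      intro y hy
      obtain ⟨z, hz, rfl⟩ := mem_members_mk.1 hy
      exact hl.down z hz⟩)
    ⟨by simp⟩
    (fun a l ha hl => ⟨by
      intro y hy
      rw [Lists'.toList_cons, List.mem_cons] at hy
      rcases hy with rfl | hy
      · exact ha.down
      · exact hl.down y hy⟩)
  obtain ⟨l, rfl⟩ := Quotient.exists_rep x
  exact (h.1 l).down

/-- Replace every occurrence of an atom `a` in a hereditary list by `f a`. -/
def mapList' (f : A → B) : {b : Bool} → Lists' A b → Lists' B b
  | _, .atom a => .atom (f a)
  | _, .nil => .nil
  | _, .cons' a l => .cons' (mapList' f a) (mapList' f l)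

/-- Replace every occurrence of an atom `a` in a hereditary list by `f a`. -/
def mapList (f : A → B) : Lists A → Lists B
  | ⟨b, l⟩ => ⟨b, mapList' f l⟩

theorem toList_mapList' (f : A → B) {b : Bool} (l : Lists' A b) :
    (mapList' f l).toList = l.toList.map (mapList f) := by
  induction l with
  | atom a => rfl
  | nil => rfl
  | cons' a l _ ih =>
    exact congrArg (List.cons (mapList f ⟨_, a⟩)) ih

theorem toList_mapList (f : A → B) : ∀ l : Lists A,
    (mapList f l).toList = l.toList.map (mapList f)
  | ⟨_, l⟩ => toList_mapList' f l

theorem mapList_equiv (f : A → B) (l l' : Lists A) (h : Lists.Equiv l l') :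
    Lists.Equiv (mapList f l) (mapList f l') := by
  have sub : ∀ l₁ l₂ : Lists' A true, l₁ ⊆ l₂ →
      (∀ y ∈ l₁.toList, ∀ w, Lists.Equiv y w → Lists.Equiv (mapList f y) (mapList f w)) →
      mapList' f l₁ ⊆ mapList' f l₂ := by
    intro l₁ l₂ h ih
    refine Lists'.subset_def.2 fun y hy => ?_
    rw [toList_mapList'] at hy
    obtain ⟨z, hz, rfl⟩ := List.mem_map.1 hy
    obtain ⟨w, hw, hzw⟩ := Lists'.mem_of_subset' h hz
    refine ⟨mapList f w, ?_, ih z hz w hzw⟩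
    rw [toList_mapList']
    exact List.mem_map_of_mem hw
  have := Lists.inductionMut (α := A)
    (fun l => PLift (∀ l' : Lists A, Lists.Equiv l l' →
      Lists.Equiv (mapList f l) (mapList f l')))
    (fun l => PLift (∀ y ∈ l.toList, ∀ l' : Lists A, Lists.Equiv y l' →
      Lists.Equiv (mapList f y) (mapList f l')))
    (fun a => ⟨by
      intro l' h
      rw [← Lists.equiv_atom.1 h]⟩)
    (fun l ih => ⟨by
      intro l' h
      cases h with
      | refl => exact Lists.Equiv.refl _
      | @antisymm _ l' h₁ h₂ =>
        refine Lists.Equiv.antisymm_iff.2 ⟨sub _ _ h₁ ih.down, sub _ _ h₂ ?_⟩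
        intro y hy w hyw
        obtain ⟨z, hz, hyz⟩ := Lists'.mem_of_subset' h₂ hy
        exact ((ih.down z hz y hyz.symm).symm).trans (ih.down z hz w (hyz.symm.trans hyw))⟩)
    ⟨by simp⟩
    (fun a l ha hl => ⟨by
      intro y hy
      rw [Lists'.toList_cons, List.mem_cons] at hy
      rcases hy with rfl | hy
      · exact ha.down
      · exact hl.down y hy⟩)
  exact (this.1 l).down l' h

/-- Replace every occurrence of an atom `a` in `x` by the atom `f a`. -/
def map (f : A → B) : HF A → HF B :=
  Quotient.map (mapList f) fun l l' h => mapList_equiv f l l' h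

theorem map_atom (f : A → B) (a : A) : map f (atom a) = atom (f a) := rfl

open Classical in
theorem members_map (f : A → B) (x : HF A) : members (map f x) = (members x).image (map f) := by
  obtain ⟨l, rfl⟩ := Quotient.exists_rep x
  ext y
  rw [show map f (Quotient.mk _ l) = mk (mapList f l) from rfl, mem_members_mk,
    toList_mapList, Finset.mem_image]
  constructor
  · rintro ⟨z, hz, rfl⟩
    obtain ⟨w, hw, rfl⟩ := List.mem_map.1 hz
    exact ⟨mk w, mem_members_mk.2 ⟨w, hw, rfl⟩, rfl⟩
  · rintro ⟨z, hz, rfl⟩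
    obtain ⟨w, hw, rfl⟩ := mem_members_mk.1 hz
    exact ⟨mapList f w, List.mem_map_of_mem hw, rfl⟩

open Classical in
theorem map_ofFinset (f : A → B) (s : Finset (HF A)) :
    map f (ofFinset s) = ofFinset (s.image (map f)) := by
  have h := members_map f (ofFinset s)
  rw [members_ofFinset] at h
  rw [← h]
  exact (ofFinset_members_mk (mapList' f (Lists'.ofList (s.toList.map Quotient.out)))).symm

/-- The transitive closure of `x`: the least transitive set that contains `x` as an element. -/
def tc (x : HF A) : Set (HF A) :=
  ⋂₀ {T : Set (HF A) | x ∈ T ∧ ∀ y ∈ T, ∀ z ∈ y, z ∈ T}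

theorem self_mem_tc (x : HF A) : x ∈ tc x := fun _ hT => hT.1

theorem tc_finite (x : HF A) : (tc x).Finite := by
  induction x using mem_induction with
  | hatom a =>
    refine (Set.finite_singleton (atom a)).subset
      (Set.sInter_subset_of_mem ⟨rfl, ?_⟩)
    rintro y rfl z hz
    rw [mem_iff, members_atom] at hz
    simp at hz
  | hset s ih =>
    refine (((Set.finite_singleton (ofFinset s)).union
      (s.finite_toSet.biUnion fun y hy => ih y hy))).subset
      (Set.sInter_subset_of_mem ⟨Or.inl rfl, ?_⟩)
    rintro y (rfl | hy) z hz
    · rw [mem_iff, members_ofFinset] at hz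
      exact Or.inr (Set.mem_biUnion hz (self_mem_tc z))
    · obtain ⟨w, hw, hyw⟩ := Set.mem_iUnion₂.1 hy
      exact Or.inr (Set.mem_biUnion hw fun T hT => hT.2 y (hyw T hT) z hz)

/-! #### Basic set-theoretic operations -/

/-- The empty set. -/
noncomputable def empty : HF A := ofFinset ∅

open Classical in
/-- `{x, y}`. -/
noncomputable def pair (x y : HF A) : HF A := ofFinset {x, y}

open Classical in
/-- The set of all elements of elements of `x`. -/
noncomputable def sUnion (x : HF A) : HF A := ofFinset ((members x).biUnion members)

open Classical in
/-- The element of `x` if `x` has exactly one element, and `∅` otherwise. -/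
noncomputable def theUnique (x : HF A) : HF A :=
  if h : ∃ y, members x = {y} then h.choose else empty

open Classical in
/-- The von Neumann ordinal `n = {0, …, n - 1}`. -/
noncomputable def ordinal : ℕ → HF A
  | 0 => empty
  | n + 1 => ofFinset (insert (ordinal n) (members (ordinal n)))

open Classical in
/-- The set of all atoms. -/
noncomputable def atoms [Fintype A] : HF A := ofFinset (Finset.univ.image atom)

open Classical in
/-- A finite set of atoms, seen as a hereditarily finite set. -/
noncomputable def ofAtoms (C : Finset A) : HF A := ofFinset (C.image atom)

end HF

/-! ### Symmetry and size -/

section Symmetry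

variable {V : Type*}

/-- `x` is fixed by every automorphism of the graph `G`. -/
def HF.IsSymmetric (G : SimpleGraph V) (x : HF V) : Prop :=
  ∀ σ : G ≃g G, HF.map σ x = x

/-- `|tc(x)| ≤ p(|V|)`. -/
def HF.IsPBounded [Fintype V] (p : Polynomial ℝ) (x : HF V) : Prop :=
  ((HF.tc x).ncard : ℝ) ≤ p.eval (Fintype.card V : ℝ)

/-- The set of all automorphic images of `x`. -/
def HF.orbit (G : SimpleGraph V) (x : HF V) : Set (HF V) :=
  Set.range fun σ : G ≃g G => HF.map σ x

end Symmetry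

/-! ### Choiceless Polynomial Time with counting (BGS logic), over graphs with an h.f. input -/

mutual

/-- BGS terms with `k` free variables. The term `compr s t φ` is `{ s(v) : v ∈ t : φ(v) }`, where
`v` becomes the variable `0` of `s` and `φ`. -/
inductive BGSTerm : ℕ → Type
  | var {k : ℕ} (i : Fin k) : BGSTerm k
  | empty {k : ℕ} : BGSTerm k
  | atoms {k : ℕ} : BGSTerm k
  | pair {k : ℕ} (s t : BGSTerm k) : BGSTerm k
  | union {k : ℕ} (t : BGSTerm k) : BGSTerm k
  | unique {k : ℕ} (t : BGSTerm k) : BGSTerm k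
  | card {k : ℕ} (t : BGSTerm k) : BGSTerm k
  | compr {k : ℕ} (s : BGSTerm (k + 1)) (t : BGSTerm k) (φ : BGSFormula (k + 1)) : BGSTerm k

/-- BGS formulas with `k` free variables over the vocabulary of graphs. -/
inductive BGSFormula : ℕ → Type
  | eq {k : ℕ} (s t : BGSTerm k) : BGSFormula k
  | mem {k : ℕ} (s t : BGSTerm k) : BGSFormula k
  | adj {k : ℕ} (s t : BGSTerm k) : BGSFormula k
  | not {k : ℕ} (φ : BGSFormula k) : BGSFormula k
  | and {k : ℕ} (φ ψ : BGSFormula k) : BGSFormula k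
  | or {k : ℕ} (φ ψ : BGSFormula k) : BGSFormula k

end

section BGS

variable {V : Type} [Fintype V]

open Classical in
mutual

/-- The value of a BGS term in `HF(G)`. -/
noncomputable def BGSTerm.eval (G : SimpleGraph V) :
    {k : ℕ} → BGSTerm k → (Fin k → HF V) → HF V
  | _, .var i, ρ => ρ i
  | _, .empty, _ => HF.empty
  | _, .atoms, _ => HF.atoms
  | _, .pair s t, ρ => HF.pair (s.eval G ρ) (t.eval G ρ)
  | _, .union t, ρ => HF.sUnion (t.eval G ρ)
  | _, .unique t, ρ => HF.theUnique (t.eval G ρ)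
  | _, .card t, ρ => HF.ordinal (HF.members (t.eval G ρ)).card
  | _, .compr s t φ, ρ =>
      HF.ofFinset (((HF.members (t.eval G ρ)).filter fun v => φ.holds G (Fin.cons v ρ)).image
        fun v => s.eval G (Fin.cons v ρ))

/-- Truth of a BGS formula in `HF(G)`. -/
noncomputable def BGSFormula.holds (G : SimpleGraph V) :
    {k : ℕ} → BGSFormula k → (Fin k → HF V) → Prop
  | _, .eq s t, ρ => s.eval G ρ = t.eval G ρ
  | _, .mem s t, ρ => s.eval G ρ ∈ t.eval G ρ
  | _, .adj s t, ρ => ∃ u v : V, s.eval G ρ = HF.atom u ∧ t.eval G ρ = HF.atom v ∧ G.Adj u v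
  | _, .not φ, ρ => ¬ φ.holds G ρ
  | _, .and φ ψ, ρ => φ.holds G ρ ∧ ψ.holds G ρ
  | _, .or φ ψ, ρ => φ.holds G ρ ∨ ψ.holds G ρ

end

end BGS

/-- A CPT-program with an h.f. input: a step term, a halting formula and an output term, whose
free variables `0` and `1` stand for the current state and for the input, together with an
explicit polynomial bound. -/
structure CPTProgram where
  step : BGSTerm 2
  halt : BGSFormula 2
  out : BGSTerm 2
  bound : Polynomial ℝ

namespace CPTProgram

variable {V : Type} [Fintype V]

/-- The run on the graph `G` and the input `x`: it starts in the state `∅` and iterates the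
step term. -/
noncomputable def state (Q : CPTProgram) (G : SimpleGraph V) (x : HF V) : ℕ → HF V
  | 0 => HF.empty
  | i + 1 => Q.step.eval G ![Q.state G x i, x]

/-- On input `G` and `x` the program halts, within its resource bound, with output `y`. Both the
number of steps and the sizes of all states and of the output are bounded polynomially in the
size of the input. -/
def Computes (Q : CPTProgram) (G : SimpleGraph V) (x y : HF V) : Prop :=
  ∃ T : ℕ,
    Q.halt.holds G ![Q.state G x T, x] ∧
    (∀ i < T, ¬ Q.halt.holds G ![Q.state G x i, x]) ∧
    Q.out.eval G ![Q.state G x T, x] = y ∧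
    (T : ℝ) ≤ Q.bound.eval ((Fintype.card V + (HF.tc x).ncard : ℕ) : ℝ) ∧
    (∀ i ≤ T, ((HF.tc (Q.state G x i)).ncard : ℝ) ≤
      Q.bound.eval ((Fintype.card V + (HF.tc x).ncard : ℕ) : ℝ)) ∧
    ((HF.tc y).ncard : ℝ) ≤ Q.bound.eval ((Fintype.card V + (HF.tc x).ncard : ℕ) : ℝ)

end CPTProgram

/-! ### Ordered partitions -/

/-- An ordered partition `(C₁, …, Cₘ)` of `V`. -/
structure OrderedPartition (V : Type*) where
  parts : List (Finset V)
  nonempty : ∀ C ∈ parts, C.Nonempty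
  disjoint : parts.Pairwise Disjoint
  cover : ∀ v : V, ∃ C ∈ parts, v ∈ C

namespace OrderedPartition

variable {V : Type*}

/-- `{C₁, {C₂, {C₃, {…}}}}`, the innermost set being `{Cₘ}`. -/
noncomputable def listToHF : List (Finset V) → HF V
  | [] => HF.empty
  | [C] => HF.ofFinset {HF.ofAtoms C}
  | C :: D :: l => HF.pair (HF.ofAtoms C) (listToHF (D :: l))

/-- The natural representation of an ordered partition as an h.f. set. -/
noncomputable def toHF (P : OrderedPartition V) : HF V := listToHF P.parts

/-- The images of the tuple `(C₁, …, Cₘ)` under the automorphisms of `G`. -/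
def orbit (G : SimpleGraph V) (P : OrderedPartition V) : Set (List (Finset V)) :=
  Set.range fun σ : G ≃g G => P.parts.map fun C => C.map σ.toEquiv.toEmbedding

end OrderedPartition

/-- `x` encodes the ordered partition `P` over `G`: some CPT-program computes the natural
representation of `P` on input `G` and `x`. -/
def Encodes {V : Type} [Fintype V] (G : SimpleGraph V) (x : HF V)
    (P : OrderedPartition V) : Prop :=
  ∃ Q : CPTProgram, Q.Computes G x P.toHF

/-- The `n`-dimensional hypercube: vertices are the bit strings of length `n`, and two of them are
adjacent if their Hamming distance is `1`. -/
def hypercube (n : ℕ) : SimpleGraph (Fin n → Bool) where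
  Adj u v := hammingDist u v = 1
  symm := ⟨fun u v h => by rwa [hammingDist_comm]⟩
  loopless := ⟨fun u h => by simp at h⟩

namespace HF

variable {A B : Type*}

open Classical in
theorem map_id (x : HF A) : map id x = x := by
  induction x using mem_induction with
  | hatom a => rfl
  | hset s ih =>
    rw [map_ofFinset]
    congr 1
    ext y
    rw [Finset.mem_image]
    constructor
    · rintro ⟨z, hz, rfl⟩
      rwa [ih z hz]
    · exact fun hy => ⟨y, hy, ih y hy⟩

open Classical in
theorem map_map {D : Type*} (g : B → D) (f : A → B) (x : HF A) :
    map g (map f x) = map (g ∘ f) x := by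
  induction x using mem_induction with
  | hatom a => rfl
  | hset s ih =>
    rw [map_ofFinset, map_ofFinset, map_ofFinset, Finset.image_image]
    congr 1
    exact Finset.image_congr fun y hy => ih y hy

theorem map_equiv_symm_map (σ : A ≃ B) (x : HF A) : map σ.symm (map σ x) = x := by
  rw [map_map, Equiv.symm_comp_self, map_id]

theorem map_equiv_injective (σ : A ≃ B) : Function.Injective (map σ : HF A → HF B) :=
  Function.LeftInverse.injective (map_equiv_symm_map σ)

theorem ofFinset_injective : Function.Injective (ofFinset : Finset (HF A) → HF A) :=
  Function.LeftInverse.injective members_ofFinset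

theorem map_mem_map (σ : A ≃ B) {x y : HF A} : map σ y ∈ map σ x ↔ y ∈ x := by
  classical
  rw [mem_iff, mem_iff, members_map, Finset.mem_image]
  exact ⟨fun ⟨z, hz, h⟩ => map_equiv_injective σ h ▸ hz, fun h => ⟨y, h, rfl⟩⟩

theorem card_members_map (σ : A ≃ B) (x : HF A) :
    (members (map σ x)).card = (members x).card := by
  classical
  rw [members_map, Finset.card_image_of_injective _ (map_equiv_injective σ)]

theorem map_empty (f : A → B) : map f empty = empty := by
  classical
  rw [empty, map_ofFinset, Finset.image_empty]
  rfl

theorem map_pair (f : A → B) (x y : HF A) : map f (pair x y) = pair (map f x) (map f y) := by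
  classical
  rw [pair, map_ofFinset, pair]
  congr 1
  ext z
  simp

theorem map_sUnion (f : A → B) (x : HF A) : map f (sUnion x) = sUnion (map f x) := by
  classical
  rw [sUnion, map_ofFinset, sUnion]
  congr 1
  ext z
  simp only [Finset.mem_image, Finset.mem_biUnion, members_map]
  constructor
  · rintro ⟨w, ⟨y, hy, hw⟩, rfl⟩
    exact ⟨_, ⟨y, hy, rfl⟩, by rw [members_map]; exact Finset.mem_image_of_mem _ hw⟩
  · rintro ⟨_, ⟨y, hy, rfl⟩, hz⟩
    rw [members_map] at hz
    obtain ⟨w, hw, rfl⟩ := Finset.mem_image.1 hz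
    exact ⟨w, ⟨y, hy, hw⟩, rfl⟩

theorem theUnique_of_members_eq {x y : HF A} (h : members x = {y}) : theUnique x = y := by
  have hex : ∃ y, members x = {y} := ⟨y, h⟩
  rw [theUnique, dif_pos hex]
  exact Finset.singleton_injective (hex.choose_spec.symm.trans h)

theorem map_theUnique (σ : A ≃ B) (x : HF A) : map σ (theUnique x) = theUnique (map σ x) := by
  classical
  by_cases h : ∃ y, members x = {y}
  · obtain ⟨y, hy⟩ := h
    rw [theUnique_of_members_eq hy, theUnique_of_members_eq (y := map σ y)]
    rw [members_map, hy, Finset.image_singleton]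
  · have h' : ¬ ∃ y, members (map σ x) = {y} := by
      rwa [← Finset.card_eq_one, card_members_map, Finset.card_eq_one]
    rw [theUnique, theUnique, dif_neg h, dif_neg h', map_empty]

theorem map_ordinal (f : A → B) (n : ℕ) : map f (ordinal n) = ordinal n := by
  classical
  induction n with
  | zero => exact map_empty f
  | succ n ih =>
    rw [ordinal, map_ofFinset, ordinal, Finset.image_insert, ih, ← members_map, ih]

theorem map_ofAtoms (σ : A ≃ B) (C : Finset A) :
    map σ (ofAtoms C) = ofAtoms (C.map σ.toEmbedding) := by
  classical
  rw [ofAtoms, map_ofFinset, ofAtoms, Finset.image_image]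
  rw [Finset.map_eq_image, Finset.image_image]
  rfl

theorem map_atoms [Fintype A] [Fintype B] (σ : A ≃ B) : map σ (atoms : HF A) = atoms := by
  have h : ∀ (D : Type _) [Fintype D], (atoms : HF D) = ofAtoms Finset.univ := fun _ _ => rfl
  rw [h, map_ofAtoms, Finset.map_univ_equiv]
  rfl

theorem mem_tc_of_mem {x y z : HF A} (hy : y ∈ tc x) (hz : z ∈ y) : z ∈ tc x :=
  fun T hT => hT.2 y (hy T hT) z hz

theorem map_mem_tc_map (σ : A ≃ B) {x y : HF A} (h : y ∈ tc x) : map σ y ∈ tc (map σ x) :=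
  h {y | map σ y ∈ tc (map σ x)}
    ⟨self_mem_tc _, fun _ hy _ hz => mem_tc_of_mem hy ((map_mem_map σ).2 hz)⟩

theorem ofAtoms_injective : Function.Injective (ofAtoms : Finset A → HF A) := by
  classical
  exact fun C D h => Finset.image_injective atom_injective (ofFinset_injective h)

/-- A set of atoms has no elements which are sets. -/
theorem ofAtoms_notMem_ofAtoms (C D : Finset A) : ofAtoms C ∉ ofAtoms D := by
  classical
  rw [mem_iff, ofAtoms, ofAtoms, members_ofFinset, Finset.mem_image]
  rintro ⟨a, -, h⟩
  exact atom_ne_ofFinset _ _ h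

theorem mem_pair {x y z : HF A} : z ∈ pair x y ↔ z = x ∨ z = y := by
  classical
  rw [mem_iff, pair, members_ofFinset, Finset.mem_insert, Finset.mem_singleton]

/-- The orbit of an element of the transitive closure of a symmetric object stays inside it. -/
theorem orbit_subset_tc {G : SimpleGraph A} {x z : HF A} (hz : z.IsSymmetric G)
    (hx : x ∈ tc z) : x.orbit G ⊆ tc z := by
  rintro _ ⟨σ, rfl⟩
  have h := map_mem_tc_map σ.toEquiv hx
  rwa [show map σ.toEquiv z = z from hz σ] at h

end HF

theorem HF.map_comp_cons {V : Type*} {k : ℕ} (f : V → V) (v : HF V) (ρ : Fin k → HF V) :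
    (fun i => HF.map f ((Fin.cons v ρ : Fin (k + 1) → HF V) i)) =
      Fin.cons (HF.map f v) (fun i => HF.map f (ρ i)) := by
  funext i
  cases i using Fin.cases <;> rfl

section Equivariance

variable {V : Type} [Fintype V] (G : SimpleGraph V) (σ : G ≃g G)

open Classical in
mutual

theorem BGSTerm.map_eval : {k : ℕ} → (t : BGSTerm k) → (ρ : Fin k → HF V) →
    HF.map σ.toEquiv (t.eval G ρ) = t.eval G (fun i => HF.map σ.toEquiv (ρ i))
  | _, .var i, ρ => by simp only [BGSTerm.eval]
  | _, .empty, ρ => by simp only [BGSTerm.eval, HF.map_empty]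
  | _, .atoms, ρ => by simp only [BGSTerm.eval, HF.map_atoms]
  | _, .pair s t, ρ => by
      simp only [BGSTerm.eval, HF.map_pair, BGSTerm.map_eval s, BGSTerm.map_eval t]
  | _, .union t, ρ => by simp only [BGSTerm.eval, HF.map_sUnion, BGSTerm.map_eval t]
  | _, .unique t, ρ => by simp only [BGSTerm.eval, HF.map_theUnique, BGSTerm.map_eval t]
  | _, .card t, ρ => by
      simp only [BGSTerm.eval, HF.map_ordinal, ← BGSTerm.map_eval t, HF.card_members_map]
  | _, .compr s t φ, ρ => by
      have hs := fun v => BGSTerm.map_eval s (Fin.cons v ρ)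
      have hφ := fun v => BGSFormula.holds_map φ (Fin.cons v ρ)
      simp only [HF.map_comp_cons] at hs hφ
      simp only [BGSTerm.eval, HF.map_ofFinset, ← BGSTerm.map_eval t]
      congr 1
      ext z
      simp only [Finset.mem_image, Finset.mem_filter, HF.members_map]
      constructor
      · rintro ⟨_, ⟨v, ⟨hv, h⟩, rfl⟩, rfl⟩
        exact ⟨_, ⟨⟨v, hv, rfl⟩, (hφ v).2 h⟩, (hs v).symm⟩
      · rintro ⟨_, ⟨⟨v, hv, rfl⟩, h⟩, rfl⟩
        exact ⟨_, ⟨v, ⟨hv, (hφ v).1 h⟩, rfl⟩, hs v⟩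

theorem BGSFormula.holds_map : {k : ℕ} → (φ : BGSFormula k) → (ρ : Fin k → HF V) →
    (φ.holds G (fun i => HF.map σ.toEquiv (ρ i)) ↔ φ.holds G ρ)
  | _, .eq s t, ρ => by
      simp only [BGSFormula.holds, ← BGSTerm.map_eval s, ← BGSTerm.map_eval t,
        (HF.map_equiv_injective σ.toEquiv).eq_iff]
  | _, .mem s t, ρ => by
      simp only [BGSFormula.holds, ← BGSTerm.map_eval s, ← BGSTerm.map_eval t, HF.map_mem_map]
  | _, .adj s t, ρ => by
      simp only [BGSFormula.holds, ← BGSTerm.map_eval s, ← BGSTerm.map_eval t]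
      have key : ∀ (x : HF V) (u : V),
          HF.map σ.toEquiv x = HF.atom u ↔ x = HF.atom (σ.toEquiv.symm u) := fun x u => by
        rw [← (HF.map_equiv_injective σ.toEquiv).eq_iff (a := x), HF.map_atom,
          Equiv.apply_symm_apply]
      simp only [key]
      constructor
      · rintro ⟨u, v, hu, hv, h⟩
        exact ⟨_, _, hu, hv, (σ.symm.map_rel_iff).2 h⟩
      · rintro ⟨u, v, hu, hv, h⟩
        exact ⟨σ.toEquiv u, σ.toEquiv v, by rw [Equiv.symm_apply_apply, hu],
          by rw [Equiv.symm_apply_apply, hv], σ.map_rel_iff.2 h⟩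
  | _, .not φ, ρ => by simp only [BGSFormula.holds, BGSFormula.holds_map φ]
  | _, .and φ ψ, ρ => by
      simp only [BGSFormula.holds, BGSFormula.holds_map φ, BGSFormula.holds_map ψ]
  | _, .or φ ψ, ρ => by
      simp only [BGSFormula.holds, BGSFormula.holds_map φ, BGSFormula.holds_map ψ]

end

theorem BGSTerm.map_eval_pair (t : BGSTerm 2) (x y : HF V) :
    HF.map σ.toEquiv (t.eval G ![x, y]) =
      t.eval G ![HF.map σ.toEquiv x, HF.map σ.toEquiv y] := by
  rw [BGSTerm.map_eval]
  congr 1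
  funext i
  fin_cases i <;> rfl

namespace CPTProgram

theorem map_state (Q : CPTProgram) (x : HF V) (i : ℕ) :
    HF.map σ.toEquiv (Q.state G x i) = Q.state G (HF.map σ.toEquiv x) i := by
  induction i with
  | zero => exact HF.map_empty _
  | succ i ih => rw [state, BGSTerm.map_eval_pair, ih, state]

variable {G}

/-- Automorphisms that fix the input fix the output. -/
theorem Computes.map_eq {Q : CPTProgram} {x y : HF V} (h : Q.Computes G x y)
    (hσ : HF.map σ.toEquiv x = x) : HF.map σ.toEquiv y = y := by
  obtain ⟨T, -, -, rfl, -⟩ := h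
  rw [BGSTerm.map_eval_pair, map_state, hσ]

end CPTProgram

end Equivariance

namespace OrderedPartition

variable {V : Type*}

theorem ofAtoms_mem_listToHF_cons_self (C : Finset V) (l : List (Finset V)) :
    HF.ofAtoms C ∈ listToHF (C :: l) := by
  cases l with
  | nil => rw [listToHF, HF.mem_iff, HF.members_ofFinset, Finset.mem_singleton]
  | cons D l => exact HF.mem_pair.2 (Or.inl rfl)

theorem listToHF_cons_ne_ofAtoms (C D : Finset V) (l : List (Finset V)) :
    listToHF (C :: l) ≠ HF.ofAtoms D := fun h =>
  HF.ofAtoms_notMem_ofAtoms C D (h ▸ ofAtoms_mem_listToHF_cons_self C l)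

theorem mem_listToHF_cons {C : Finset V} {l : List (Finset V)} {z : HF V} :
    z ∈ listToHF (C :: l) ↔ z = HF.ofAtoms C ∨ (l ≠ [] ∧ z = listToHF l) := by
  cases l with
  | nil => simp [listToHF, HF.mem_iff, HF.members_ofFinset]
  | cons D l => simp [listToHF, HF.mem_pair]

theorem ofAtoms_mem_listToHF_cons {C D : Finset V} {l : List (Finset V)} :
    HF.ofAtoms D ∈ listToHF (C :: l) ↔ D = C := by
  rw [mem_listToHF_cons, HF.ofAtoms_injective.eq_iff, or_iff_left_iff_imp]
  rintro ⟨hl, h⟩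
  obtain ⟨E, l, rfl⟩ := List.exists_cons_of_ne_nil hl
  exact (listToHF_cons_ne_ofAtoms _ _ _ h.symm).elim

theorem listToHF_nil_ne_cons (C : Finset V) (l : List (Finset V)) :
    listToHF [] ≠ listToHF (C :: l) := by
  intro h
  have hC := ofAtoms_mem_listToHF_cons_self C l
  rw [← h, listToHF, HF.mem_iff, HF.empty, HF.members_ofFinset] at hC
  simp at hC

theorem listToHF_injective : Function.Injective (listToHF : List (Finset V) → HF V) := by
  intro l
  induction l with
  | nil =>
    rintro (_ | ⟨C, l'⟩) h
    · rfl
    · exact (listToHF_nil_ne_cons C l' h).elim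
  | cons C l ih =>
    rintro (_ | ⟨D, l'⟩) h
    · exact (listToHF_nil_ne_cons C l h.symm).elim
    obtain rfl : C = D := ofAtoms_mem_listToHF_cons.1 (h ▸ ofAtoms_mem_listToHF_cons_self C l)
    have tail : ∀ {l₁ l₂ : List (Finset V)}, listToHF (C :: l₁) = listToHF (C :: l₂) →
        l₁ ≠ [] → l₂ ≠ [] ∧ listToHF l₁ = listToHF l₂ := by
      intro l₁ l₂ h h₁
      have hm : listToHF l₁ ∈ listToHF (C :: l₂) := h ▸ mem_listToHF_cons.2 (Or.inr ⟨h₁, rfl⟩)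
      refine (mem_listToHF_cons.1 hm).resolve_left ?_
      obtain ⟨E, l₁, rfl⟩ := List.exists_cons_of_ne_nil h₁
      exact listToHF_cons_ne_ofAtoms _ _ _
    by_cases hl : l = []
    · by_cases hl' : l' = []
      · rw [hl, hl']
      · exact ((tail h.symm hl').1 hl).elim
    · rw [ih (tail h hl).2]

theorem map_listToHF (σ : V ≃ V) (l : List (Finset V)) :
    HF.map σ (listToHF l) = listToHF (l.map fun C => C.map σ.toEmbedding) := by
  classical
  induction l with
  | nil => exact HF.map_empty _
  | cons C l ih =>
    cases l with
    | nil =>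
      rw [listToHF, HF.map_ofFinset, Finset.image_singleton, HF.map_ofAtoms]
      rfl
    | cons D l =>
      rw [listToHF, HF.map_pair, ih, HF.map_ofAtoms]
      rfl

end OrderedPartition

theorem Set.ncard_range_le_of_factorsThrough {ι α β : Type*} [Finite ι] {f : ι → α} {g : ι → β}
    (h : Function.FactorsThrough g f) : (Set.range g).ncard ≤ (Set.range f).ncard := by
  rcases isEmpty_or_nonempty ι with hι | hι
  · rw [Set.range_eq_empty, Set.range_eq_empty, Set.ncard_empty, Set.ncard_empty]
  · have hne : Nonempty β := hι.map g
    obtain ⟨e, rfl⟩ := (Function.factorsThrough_iff g).1 h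
    rw [Set.range_comp]
    exact Set.ncard_image_le (Set.finite_range f)

theorem SimpleGraph.finite_aut {V : Type*} [Finite V] (G : SimpleGraph V) : Finite (G ≃g G) :=
  DFunLike.finite _

/-- An encoding has at least as many automorphic images as the ordered partition it encodes. -/
theorem Encodes.ncard_orbit_le {V : Type} [Fintype V] {G : SimpleGraph V} {x : HF V}
    {P : OrderedPartition V} (h : Encodes G x P) :
    (P.orbit G).ncard ≤ (x.orbit G).ncard := by
  obtain ⟨Q, hQ⟩ := h
  have := G.finite_aut
  refine Set.ncard_range_le_of_factorsThrough fun σ τ hστ => ?_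
  apply OrderedPartition.listToHF_injective
  rw [← OrderedPartition.map_listToHF, ← OrderedPartition.map_listToHF]
  have hx : HF.map (σ.trans τ.symm).toEquiv x = x := by
    have h : HF.map τ.toEquiv.symm (HF.map σ.toEquiv x) = HF.map τ.toEquiv.symm
      (HF.map τ.toEquiv x) := congrArg (HF.map τ.toEquiv.symm) hστ
    rwa [HF.map_equiv_symm_map, HF.map_map] at h
  have hy := congrArg (HF.map τ.toEquiv) (hQ.map_eq (σ.trans τ.symm) hx)
  rw [HF.map_map] at hy
  have hcomp : τ.toEquiv ∘ (σ.trans τ.symm).toEquiv = σ.toEquiv :=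
    funext fun v => τ.toEquiv.apply_symm_apply (σ v)
  rwa [hcomp] at hy

section Hypercube

variable {n : ℕ}

/-- The automorphism of the hypercube which permutes the coordinates. -/
def hypercubePerm (π : Equiv.Perm (Fin n)) : hypercube n ≃g hypercube n where
  toEquiv := π.arrowCongr (Equiv.refl Bool)
  map_rel_iff' := by
    intro u v
    change hammingDist (u ∘ π.symm) (v ∘ π.symm) = 1 ↔ hammingDist u v = 1
    rw [show hammingDist (u ∘ π.symm) (v ∘ π.symm) = hammingDist u v from
      Finset.card_equiv π.symm (by simp)]

theorem hypercubePerm_apply (π : Equiv.Perm (Fin n)) (v : Fin n → Bool) (j : Fin n) :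
    (hypercubePerm π).toEquiv v (π j) = v j := by
  change v (π.symm (π j)) = v j
  rw [Equiv.symm_apply_apply]

/-- The characteristic vector of the pair `{2i, 2i + 1}` of coordinates. -/
def pairVector (n i : ℕ) : Fin n → Bool := fun j => decide (j.val / 2 = i)

/-- Which coordinates are mapped above their partner by `π`. -/
def abovePartner (π : Equiv.Perm (Fin n)) (j : Fin n) : Bool :=
  decide (∃ k : Fin n, k.val / 2 = j.val / 2 ∧ π k < π j)

/-- A permutation is determined by its action on the pairs `{2i, 2i + 1}` and by the order of the
images of the two elements of each pair. -/
theorem perm_eq_of_pairVector {π τ : Equiv.Perm (Fin n)}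
    (hvec : ∀ i < (n + 1) / 2, (hypercubePerm π).toEquiv (pairVector n i) =
      (hypercubePerm τ).toEquiv (pairVector n i))
    (hord : abovePartner π = abovePartner τ) : π = τ := by
  have key : ∀ j, ∃ k : Fin n, τ k = π j ∧ k.val / 2 = j.val / 2 := by
    intro j
    refine ⟨τ.symm (π j), Equiv.apply_symm_apply _ _, ?_⟩
    have h := congrFun (hvec (j.val / 2) (by omega)) (π j)
    rw [hypercubePerm_apply, ← Equiv.apply_symm_apply τ (π j), hypercubePerm_apply] at h
    simpa [pairVector] using h
  ext j
  obtain ⟨k, hk, hkj⟩ := key j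
  by_cases hjk : k = j
  · rw [← hk, hjk]
  obtain ⟨i, hi, hik⟩ := key k
  have hik' : i ≠ k := by
    rintro rfl
    exact hjk (π.injective (hi.symm.trans hk))
  have hij : i = j := by
    have h₁ : i.val ≠ k.val := fun h => hik' (Fin.ext h)
    have h₂ : k.val ≠ j.val := fun h => hjk (Fin.ext h)
    exact Fin.ext (by omega)
  subst hij
  have hpartner : ∀ ρ : Equiv.Perm (Fin n),
      (∃ l : Fin n, l.val / 2 = i.val / 2 ∧ ρ l < ρ i) ↔ ρ k < ρ i := by
    intro ρ
    constructor
    · rintro ⟨l, hl, hlt⟩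
      have h₁ : l ≠ i := by
        rintro rfl
        exact lt_irrefl _ hlt
      have h₂ : l.val ≠ i.val := fun h => h₁ (Fin.ext h)
      have h₃ : i.val ≠ k.val := fun h => hik' (Fin.ext h)
      rwa [← show l = k from Fin.ext (by omega)]
    · exact fun h => ⟨k, hkj, h⟩
  have h := congrFun hord i
  simp only [abovePartner, hpartner, decide_eq_decide] at h
  rw [hk, ← hi] at h
  have hne : τ i ≠ τ k := fun h => hik' (τ.injective h)
  rcases lt_or_gt_of_ne hne with h' | h'
  · rw [hk] at h'
    exact (lt_asymm h' (h.1 h')).elim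
  · rw [hk] at h'
    exact (lt_asymm h' (h.2 h')).elim

namespace OrderedPartition

/-- If all parts of `P` are small, then the coordinate permutations alone give `P` a large
orbit. -/
theorem factorial_le_ncard_orbit (P : OrderedPartition (Fin n → Bool)) {b : ℕ}
    (hb : ∀ C ∈ P.parts, C.card ≤ b) :
    n.factorial ≤ b ^ ((n + 1) / 2) * 2 ^ n * (P.orbit (hypercube n)).ncard := by
  classical
  let F : Equiv.Perm (Fin n) → List (Finset (Fin n → Bool)) := fun π =>
    P.parts.map fun C => C.map (hypercubePerm π).toEquiv.toEmbedding
  have hfin := (hypercube n).finite_aut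
  have himage : (Finset.univ.image F).card ≤ (P.orbit (hypercube n)).ncard := by
    rw [← Set.ncard_coe_finset]
    refine Set.ncard_le_ncard ?_ (Set.finite_range _)
    intro L hL
    obtain ⟨π, -, rfl⟩ := Finset.mem_image.1 (Finset.mem_coe.1 hL)
    exact ⟨hypercubePerm π, rfl⟩
  choose C hC hvC using P.cover
  have hfiber : ∀ L ∈ Finset.univ.image F,
      (Finset.univ.filter fun π => F π = L).card ≤ b ^ ((n + 1) / 2) * 2 ^ n := by
    intro L hL
    obtain ⟨τ, -, rfl⟩ := Finset.mem_image.1 hL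
    let S : Finset ((Fin ((n + 1) / 2) → (Fin n → Bool)) × (Fin n → Bool)) :=
      (Fintype.piFinset fun i : Fin ((n + 1) / 2) =>
        (C (pairVector n i)).map (hypercubePerm τ).toEquiv.toEmbedding) ×ˢ Finset.univ
    have hS : S.card ≤ b ^ ((n + 1) / 2) * 2 ^ n := by
      rw [Finset.card_product, Fintype.card_piFinset, Finset.card_univ, Fintype.card_fun,
        Fintype.card_bool, Fintype.card_fin]
      refine Nat.mul_le_mul_right _ ?_
      refine (Finset.prod_le_pow_card _ _ b fun i _ => ?_).trans ?_
      · rw [Finset.card_map]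
        exact hb _ (hC _)
      · rw [Finset.card_univ, Fintype.card_fin]
    refine le_trans (Finset.card_le_card_of_injOn (t := S)
      (fun π => (fun i => (hypercubePerm π).toEquiv (pairVector n i), abovePartner π))
      ?_ ?_) hS
    · intro π hπ
      have hπ' : F π = F τ := (Finset.mem_filter.1 (Finset.mem_coe.1 hπ)).2
      refine Finset.mem_coe.2 (Finset.mem_product.2 ⟨Fintype.mem_piFinset.2 fun i => ?_,
        Finset.mem_univ _⟩)
      rw [← List.map_inj_left.1 hπ' _ (hC (pairVector n i))]
      exact Finset.mem_map_of_mem _ (hvC _)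
    · intro π _ ρ _ h
      obtain ⟨h₁, h₂⟩ := Prod.mk.inj h
      exact perm_eq_of_pairVector (fun i hi => congrFun h₁ ⟨i, hi⟩) h₂
  calc n.factorial = (Finset.univ : Finset (Equiv.Perm (Fin n))).card := by
        rw [Finset.card_univ, Fintype.card_perm, Fintype.card_fin]
    _ ≤ b ^ ((n + 1) / 2) * 2 ^ n * (Finset.univ.image F).card :=
        Finset.card_le_mul_card_image _ _ hfiber
    _ ≤ _ := Nat.mul_le_mul_left _ himage

end OrderedPartition

end Hypercube

theorem Nat.pow_self_le_four_pow_mul_factorial (n : ℕ) : n ^ n ≤ 4 ^ n * n.factorial := by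
  have h := Real.pow_div_factorial_le_exp (n : ℝ) n.cast_nonneg n
  rw [div_le_iff₀ (by exact_mod_cast n.factorial_pos)] at h
  have he : Real.exp n ≤ 4 ^ n := by
    rw [← Real.exp_one_pow]
    exact pow_le_pow_left₀ (Real.exp_pos 1).le (by linarith [Real.exp_one_lt_d9]) n
  have h' : (n : ℝ) ^ n ≤ 4 ^ n * n.factorial :=
    h.trans (mul_le_mul_of_nonneg_right he (by positivity))
  exact_mod_cast h'

/-- The factorial dominates every function `(d n) ^ ⌈n / 2⌉ * K ^ n`. -/
theorem Nat.eventually_pow_mul_pow_le_factorial (d K : ℕ) :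
    ∀ᶠ n : ℕ in atTop, (d * n) ^ ((n + 1) / 2) * K ^ n ≤ n.factorial := by
  filter_upwards [eventually_ge_atTop (((d + 1) * (K + 1) * 4) ^ 3), eventually_ge_atTop 2]
    with n hn h2
  have hsum : (n + 1) / 2 + n / 2 = n := by omega
  have hlarge : ((d + 1) * (K + 1) * 4) ^ n ≤ n ^ (n / 2) :=
    calc ((d + 1) * (K + 1) * 4) ^ n ≤ ((d + 1) * (K + 1) * 4) ^ (3 * (n / 2)) :=
          Nat.pow_le_pow_right (by positivity) (by omega)
      _ = (((d + 1) * (K + 1) * 4) ^ 3) ^ (n / 2) := pow_mul _ _ _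
      _ ≤ n ^ (n / 2) := Nat.pow_le_pow_left hn _
  have hd : d ^ ((n + 1) / 2) ≤ (d + 1) ^ n :=
    (Nat.pow_le_pow_left d.le_succ _).trans (Nat.pow_le_pow_right d.succ_pos (by omega))
  have hK : K ^ n ≤ (K + 1) ^ n := Nat.pow_le_pow_left K.le_succ _
  refine Nat.le_of_mul_le_mul_left (c := 4 ^ n) ?_ (by positivity)
  calc 4 ^ n * ((d * n) ^ ((n + 1) / 2) * K ^ n)
      = n ^ ((n + 1) / 2) * (d ^ ((n + 1) / 2) * K ^ n * 4 ^ n) := by rw [mul_pow]; ring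
    _ ≤ n ^ ((n + 1) / 2) * ((d + 1) ^ n * (K + 1) ^ n * 4 ^ n) := by gcongr
    _ = n ^ ((n + 1) / 2) * ((d + 1) * (K + 1) * 4) ^ n := by rw [mul_pow, mul_pow]
    _ ≤ n ^ ((n + 1) / 2) * n ^ (n / 2) := Nat.mul_le_mul_left _ hlarge
    _ = n ^ n := by rw [← pow_add, hsum]
    _ ≤ 4 ^ n * n.factorial := Nat.pow_self_le_four_pow_mul_factorial n

theorem Polynomial.eventually_eval_lt_pow (p : Polynomial ℝ) :
    ∀ᶠ y : ℝ in atTop, p.eval y < y ^ (p.natDegree + 1) := by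
  have h : (fun y => p.eval y) =o[atTop] fun y =>
      (Polynomial.X ^ (p.natDegree + 1) : Polynomial ℝ).eval y := by
    apply Polynomial.isLittleO_atTop_of_degree_lt
    rw [Polynomial.degree_X_pow]
    exact Polynomial.degree_le_natDegree.trans_lt (by exact_mod_cast Nat.lt_succ_self _)
  filter_upwards [h.bound (show (0 : ℝ) < 1 / 2 by norm_num), eventually_gt_atTop 0] with y hy h0
  have hpos : 0 < y ^ (p.natDegree + 1) := pow_pos h0 _
  rw [Polynomial.eval_pow, Polynomial.eval_X, Real.norm_of_nonneg hpos.le] at hy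
  linarith [le_abs_self (p.eval y), Real.norm_eq_abs (p.eval y)]

/-- Ordered partitions of the hypercubes into parts of logarithmic size have superpolynomial
orbits. -/
theorem OrderedPartition.eventually_eval_lt_ncard_orbit
    (P : ∀ n : ℕ, OrderedPartition (Fin n → Bool))
    (hP : ∃ c : ℝ, ∀ᶠ n : ℕ in atTop, ∀ C ∈ (P n).parts, (C.card : ℝ) ≤ c * n)
    (p : Polynomial ℝ) :
    ∀ᶠ n : ℕ in atTop, p.eval ((2 : ℝ) ^ n) < ((P n).orbit (hypercube n)).ncard := by
  obtain ⟨c, hc⟩ := hP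
  set k := p.natDegree + 1
  have htwo : Tendsto (fun n : ℕ => (2 : ℝ) ^ n) atTop atTop :=
    tendsto_pow_atTop_atTop_of_one_lt one_lt_two
  filter_upwards [hc, htwo.eventually p.eventually_eval_lt_pow, eventually_gt_atTop 0,
    Nat.eventually_pow_mul_pow_le_factorial (⌈c⌉₊ + 1) (2 * 2 ^ k)] with n hcn hpn h0 hfact
  have hcard : ∀ C ∈ (P n).parts, C.card ≤ (⌈c⌉₊ + 1) * n := by
    intro C hC
    have h : (C.card : ℝ) ≤ (⌈c⌉₊ + 1) * n :=
      (hcn C hC).trans (mul_le_mul_of_nonneg_right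
        ((Nat.le_ceil c).trans (lt_add_one _).le) n.cast_nonneg)
    exact_mod_cast h
  have h := hfact.trans ((P n).factorial_le_ncard_orbit hcard)
  rw [mul_pow 2 (2 ^ k) n, ← mul_assoc] at h
  have h' := Nat.le_of_mul_le_mul_left h (by positivity)
  refine hpn.trans_le ?_
  rw [← pow_mul, mul_comm, pow_mul]
  exact_mod_cast h'

theorem theorem1 (P : ∀ n : ℕ, OrderedPartition (Fin n → Bool))
    (hP : ∃ c : ℝ, ∀ᶠ n : ℕ in atTop, ∀ C ∈ (P n).parts, (C.card : ℝ) ≤ c * n)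
    (x : ∀ n : ℕ, HF (Fin n → Bool))
    (hx : ∀ n, Encodes (hypercube n) (x n) (P n)) :
    -- the orbits of `P n` and of `x n` grow super-polynomially in `|H_n| = 2 ^ n`
    (∀ p : Polynomial ℝ, ∀ᶠ n : ℕ in atTop,
      p.eval ((2 : ℝ) ^ n) < ((P n).orbit (hypercube n)).ncard) ∧
    (∀ p : Polynomial ℝ, ∀ᶠ n : ℕ in atTop,
      p.eval ((2 : ℝ) ^ n) < ((x n).orbit (hypercube n)).ncard) ∧
    -- no symmetric objects `z n` that contain `x n` (in particular, no symmetric `x n`)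
    -- are polynomially bounded
    (∀ z : ∀ n : ℕ, HF (Fin n → Bool),
      (∀ n, (z n).IsSymmetric (hypercube n)) → (∀ n, x n ∈ HF.tc (z n)) →
      ∀ p : Polynomial ℝ, ∀ᶠ n : ℕ in atTop, ¬ (z n).IsPBounded p) := by
  have hpart := OrderedPartition.eventually_eval_lt_ncard_orbit P hP
  have horbit : ∀ p : Polynomial ℝ, ∀ᶠ n : ℕ in atTop,
      p.eval ((2 : ℝ) ^ n) < ((x n).orbit (hypercube n)).ncard := by
    intro p
    filter_upwards [hpart p] with n hn
    exact hn.trans_le (Nat.cast_le.2 (hx n).ncard_orbit_le)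
  refine ⟨hpart, horbit, fun z hz hxz p => ?_⟩
  filter_upwards [horbit p] with n hn hbound
  have hle := Set.ncard_le_ncard (HF.orbit_subset_tc (hz n) (hxz n)) (HF.tc_finite (z n))
  rw [HF.IsPBounded, Fintype.card_fun, Fintype.card_bool, Fintype.card_fin] at hbound
  push_cast at hbound
  exact absurd (hn.trans_le (Nat.cast_le.2 hle)) hbound.not_gt
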